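/- A Minkowski norm on $\mathbb{R}^n$ ($n\ge 2$) is a continuous function $F:\mathbb{R}^n\to\mathbb{R}$ that is positive and smooth on $\mathbb{R}^n\setminus\{0\}$, satisfies $F(\lambda x)=\lambda F(x)$ for all $\lambda\ge 0$ and all $x$, and for which the Hessian of $\tfrac12F^2$ is positive definite at every $x\ne 0$. Let $n\ge 2$, let $\alpha$ be a Euclidean norm on $\mathbb{R}^n$ (the norm of an arbitrary inner product), let $\mathbb{R}^n=\mathbf V'\oplus\mathbf V''$ be an $\alpha$-orthogonal decomposition with $0<\dim\mathbf V'<n$, write $x=x_1+x_2$ with $x_1\in\mathbf V'$ and $x_2\in\mathbf V''$, and let $\varphi:[0,1]\to\mathbb{R}$ be a positive function. Then $$F(x)=\alpha(x)\,\varphi\!\left(\frac{\alpha(x_1)}{\alpha(x)}\right)\quad (x\neq 0),\qquad F(0)=0,$$ is a Minkowski norm on $\mathbb{R}^n$ if and only if both $s\mapsto\varphi(s)$ and $s\mapsto\varphi(\sqrt{1-s^2})$ are smooth ($C^\infty$, with one-sided derivatives at the endpoints) on $[0,1]$ and $$\varphi(s)-s\,\varphi'(s)+(1-s^2)\,\varphi''(s)>0\qquad\text{for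 all } s\in[0,1].$$ -/

import Mathlib

open scoped ContDiff

/-- `F` is a Minkowski norm on the finite-dimensional real vector space `E`: continuous, positive
and smooth away from the origin, positively 1-homogeneous, and strongly convex, that is, the
Hessian of `(1/2) F ^ 2` is positive definite at every nonzero point. -/
structure IsMinkowskiNorm {E : Type*} [NormedAddCommGroup E] [NormedSpace ℝ E]
    (F : E → ℝ) : Prop where
  continuous : Continuous F
  pos : ∀ x : E, x ≠ 0 → 0 < F x
  smooth : ContDiffOn ℝ ∞ F {x : E | x ≠ 0}
  homogeneous : ∀ c : ℝ, 0 ≤ c → ∀ x : E, F (c • x) = c * F x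
  stronglyConvex : ∀ x : E, x ≠ 0 → ∀ v : E, v ≠ 0 →
    0 < fderiv ℝ (fderiv ℝ (fun y : E => (1 / 2 : ℝ) * F y ^ 2)) x v v

/-- `B` is an inner product: a symmetric, positive definite bilinear form. -/
structure IsRealInnerProduct {E : Type*} [AddCommGroup E] [Module ℝ E]
    (B : LinearMap.BilinForm ℝ E) : Prop where
  symm : ∀ x y : E, B x y = B y x
  pos : ∀ x : E, x ≠ 0 → 0 < B x x

/-- The Euclidean norm `α(x) = √(B(x, x))` of an inner product `B`. -/
noncomputable def euclideanNormOf {E : Type*} [AddCommGroup E] [Module ℝ E]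
    (B : LinearMap.BilinForm ℝ E) (x : E) : ℝ :=
  Real.sqrt (B x x)

/-- The function `F(x) = α(x) φ(α(x₁) / α(x))`, where `α` is the Euclidean norm of `B` and
`x = x₁ + x₂` with `x₁ ∈ V'` and `x₂ ∈ V''`. At `x = 0` its value is `0`, since `α(0) = 0`. -/
noncomputable def alphaPhi {E : Type*} [AddCommGroup E] [Module ℝ E]
    (B : LinearMap.BilinForm ℝ E) (V' V'' : Submodule ℝ E) (hV : IsCompl V' V'')
    (φ : ℝ → ℝ) (x : E) : ℝ :=
  euclideanNormOf B x *
    φ (euclideanNormOf B (V'.projection V'' hV x) / euclideanNormOf B x)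

/-! Put `f(σ) = φ(√σ)`, `N(x) = B(x, x)`, `P(x) = B(x₁, x₁)`. Then `½F² = ½ N f(P/N)²` with `N`, `P`
quadratic, so everything reduces to `f` on `[0, 1]`. Smoothness of `f` is equivalent to that of both
`φ(s)` and `φ(√(1-s²))`, and the differential condition becomes `E = f + 2(1-2σ)f' + 4σ(1-σ)f'' >
0`.

Sufficiency: after a square is completed, the Hessian is governed by three quantities: `E` on the
plane of `x₁, x₂`, `f + 2(1-σ)f'` on the rest of `V'`, and `f - 2σf'` on the rest of `V''`.
Positivity of `E` forces that of the other two (`HasTwoDerivsOnUnit.sub_pos`,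
`HasTwoDerivsOnUnit.add_pos`); `hessianForm_pos` combines them.

Necessity: restrict `F` to a plane spanned by unit vectors of `V'` and `V''`. Along affine lines `F`
is smooth and even, so Whitney's theorem makes `f` smooth. The Hessian in a suitable direction
equals `f E`. -/

open Set

/-! ### Smooth even functions and Whitney's theorem -/

/-- The weighted average `∫₀¹ sᵏ g(s t) ds`, a smooth function of `t` when `g` is smooth. -/
noncomputable def weightedAverage (k : ℕ) (g : ℝ → ℝ) (t : ℝ) : ℝ :=
  ∫ s in (0 : ℝ)..1, s ^ k * g (s * t)

theorem hasDerivAt_weightedAverage (k : ℕ) {g : ℝ → ℝ} (hg : ContDiff ℝ ∞ g) (t : ℝ) :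
    HasDerivAt (weightedAverage k g) (weightedAverage (k + 1) (deriv g) t) t := by
  have hg' : ContDiff ℝ ∞ (deriv g) := (contDiff_infty_iff_deriv.1 hg).2
  have hgc := hg.continuous
  have hgc' := hg'.continuous
  obtain ⟨C, hC⟩ := (isCompact_Icc (a := -(|t| + 1)) (b := |t| + 1)).exists_bound_of_continuousOn
    hgc'.continuousOn
  have hcont : ∀ x, Continuous fun s : ℝ => s ^ k * g (s * x) := fun x => by fun_prop
  refine (intervalIntegral.hasDerivAt_integral_of_dominated_loc_of_deriv_le
    (F := fun x s => s ^ k * g (s * x)) (F' := fun x s => s ^ (k + 1) * deriv g (s * x))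
    (bound := fun _ => C) (Metric.ball_mem_nhds t one_pos)
    (Filter.Eventually.of_forall fun x => (hcont x).aestronglyMeasurable)
    ((hcont t).intervalIntegrable _ _) ?_ ?_ (by simp) ?_).2
  · exact (by fun_prop : Continuous fun s : ℝ => s ^ (k + 1) * deriv g (s * t)).aestronglyMeasurable
  · refine Filter.Eventually.of_forall fun s hs x hx => ?_
    rw [uIoc_of_le zero_le_one] at hs
    rw [Metric.mem_ball, Real.dist_eq] at hx
    have hxt : |x| ≤ |t| + 1 := by
      have := abs_sub_abs_le_abs_sub x t
      linarith
    have hsx : |s * x| ≤ |t| + 1 := by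
      rw [abs_mul, abs_of_pos hs.1]
      exact (mul_le_of_le_one_left (abs_nonneg x) hs.2).trans hxt
    rw [norm_mul, norm_pow, Real.norm_of_nonneg hs.1.le]
    exact (mul_le_of_le_one_left (norm_nonneg _) (pow_le_one₀ hs.1.le hs.2)).trans
      (hC _ (abs_le.1 hsx))
  · refine Filter.Eventually.of_forall fun s _ x _ => ?_
    have h1 : HasDerivAt g (deriv g (s * x)) (s * x) :=
      (hg.differentiable (by simp)).differentiableAt.hasDerivAt
    have h2 : HasDerivAt (fun x : ℝ => s * x) s x := by
      simpa using (hasDerivAt_id x).const_mul s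
    exact ((h1.comp x h2).const_mul (s ^ k)).congr_deriv (by ring)

theorem contDiff_weightedAverage (k : ℕ) {g : ℝ → ℝ} (hg : ContDiff ℝ ∞ g) :
    ContDiff ℝ ∞ (weightedAverage k g) := by
  -- Differentiation raises `k` and replaces `g` by `deriv g`, so the induction must range over
  -- both.
  have key : ∀ (n : ℕ) (k : ℕ) (g : ℝ → ℝ), ContDiff ℝ ∞ g →
      ContDiff ℝ n (weightedAverage k g) := by
    intro n
    induction n with
    | zero =>
      intro k g hg
      rw [Nat.cast_zero, contDiff_zero]
      exact Differentiable.continuous fun t =>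
        (hasDerivAt_weightedAverage k hg t).differentiableAt
    | succ n ih =>
      intro k g hg
      rw [Nat.cast_succ, contDiff_succ_iff_deriv]
      refine ⟨fun t => (hasDerivAt_weightedAverage k hg t).differentiableAt, by simp, ?_⟩
      rw [funext fun t => (hasDerivAt_weightedAverage k hg t).deriv]
      exact ih _ _ (contDiff_infty_iff_deriv.1 hg).2
  exact contDiff_infty.2 fun n => key n k g hg

/-- Hadamard's lemma in one variable. -/
theorem eq_mul_weightedAverage_deriv {g : ℝ → ℝ} (hg : ContDiff ℝ ∞ g) (h0 : g 0 = 0) (t : ℝ) :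
    g t = t * weightedAverage 0 (deriv g) t := by
  have hg' : Continuous (deriv g) := (contDiff_infty_iff_deriv.1 hg).2.continuous
  have h := intervalIntegral.integral_eq_sub_of_hasDerivAt (a := 0) (b := 1)
    (f := fun s => g (s * t)) (f' := fun s => t * deriv g (s * t)) (fun s _ => by
      have h1 : HasDerivAt g (deriv g (s * t)) (s * t) :=
        (hg.differentiable (by simp)).differentiableAt.hasDerivAt
      have h2 : HasDerivAt (fun s : ℝ => s * t) t s := by
        simpa using (hasDerivAt_id s).mul_const t
      exact (h1.comp s h2).congr_deriv (by ring))
    ((by fun_prop : Continuous fun s => t * deriv g (s * t)).intervalIntegrable _ _)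
  rw [intervalIntegral.integral_const_mul] at h
  simpa [weightedAverage, h0] using h.symm

theorem deriv_neg_of_even {g : ℝ → ℝ} (he : ∀ t, g (-t) = g t) (t : ℝ) :
    deriv g (-t) = -deriv g t := by
  have h := deriv_comp_neg g (-t)
  rw [funext he, neg_neg] at h
  exact h

/-- Whitney: a smooth even function is a smooth function of the square. -/
theorem contDiffOn_comp_sqrt_of_even {g : ℝ → ℝ} (hg : ContDiff ℝ ∞ g) (he : ∀ t, g (-t) = g t) :
    ContDiffOn ℝ ∞ (fun x => g (Real.sqrt x)) (Ici 0) := by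
  have key : ∀ (n : ℕ) (g : ℝ → ℝ), ContDiff ℝ ∞ g → (∀ t, g (-t) = g t) →
      ContDiffOn ℝ n (fun x => g (Real.sqrt x)) (Ici 0) := by
    intro n
    induction n with
    | zero =>
      intro g hg _
      rw [Nat.cast_zero, contDiffOn_zero]
      exact (hg.continuous.comp Real.continuous_sqrt).continuousOn
    | succ n ih =>
      intro g hg he
      have hg' : ContDiff ℝ ∞ (deriv g) := (contDiff_infty_iff_deriv.1 hg).2
      have hg'' : ContDiff ℝ ∞ (deriv (deriv g)) := (contDiff_infty_iff_deriv.1 hg').2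
      have hg'0 : deriv g 0 = 0 := by
        have := deriv_neg_of_even he 0
        rw [neg_zero] at this
        linarith
      -- The derivative of `g(√x)` is `g'(√x) / (2√x)`. As `g'` is odd, Hadamard's lemma gives
      -- `g'(t) / (2t) = q(t)` with `q` smooth and even, so the induction applies to `q`.
      set q : ℝ → ℝ := fun t => weightedAverage 0 (deriv (deriv g)) t / 2 with hq
      have hqs : ContDiff ℝ ∞ q := (contDiff_weightedAverage 0 hg'').div_const 2
      have hqe : ∀ t, q (-t) = q t := by
        intro t
        have h2 : ∀ t, deriv (deriv g) (-t) = deriv (deriv g) t := by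
          intro t
          have h := deriv_comp_neg (deriv g) t
          rw [funext (deriv_neg_of_even he), deriv.fun_neg] at h
          linarith
        simp only [hq, weightedAverage, mul_neg, h2]
      have hpos : ∀ x : ℝ, 0 < x → HasDerivAt (fun x => g (Real.sqrt x)) (q (Real.sqrt x)) x := by
        intro x hx
        have hs : 0 < Real.sqrt x := Real.sqrt_pos.2 hx
        have h1 : HasDerivAt g (deriv g (Real.sqrt x)) (Real.sqrt x) :=
          (hg.differentiable (by simp)).differentiableAt.hasDerivAt
        refine (h1.comp x (Real.hasDerivAt_sqrt hx.ne')).congr_deriv ?_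
        rw [eq_mul_weightedAverage_deriv hg' hg'0]
        simp only [hq]
        field_simp
      have hcont : Continuous fun x => g (Real.sqrt x) := hg.continuous.comp Real.continuous_sqrt
      have hqcont : Continuous fun x => q (Real.sqrt x) := hqs.continuous.comp Real.continuous_sqrt
      have hd : ∀ x ∈ Ici (0 : ℝ),
          HasDerivWithinAt (fun x => g (Real.sqrt x)) (q (Real.sqrt x)) (Ici 0) x := by
        intro x hx
        rcases (mem_Ici.1 hx).eq_or_lt with rfl | hx
        -- The square root is not differentiable at `0`; the one-sided derivative is the limit of
        -- the derivatives from the right.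
        · refine hasDerivWithinAt_Ici_of_tendsto_deriv (s := Ioi 0)
            (fun y hy => (hpos y hy).differentiableAt.differentiableWithinAt)
            hcont.continuousWithinAt self_mem_nhdsWithin ?_
          refine (hqcont.continuousWithinAt (s := Ioi 0) (x := 0)).tendsto.congr' ?_
          filter_upwards [self_mem_nhdsWithin] with y hy
          exact (hpos y hy).deriv.symm
        · exact (hpos x hx).hasDerivWithinAt
      rw [Nat.cast_succ, contDiffOn_succ_iff_derivWithin (uniqueDiffOn_Ici 0)]
      refine ⟨fun x hx => (hd x hx).differentiableWithinAt, by simp, ?_⟩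
      exact (ih q hqs hqe).congr fun x hx => (hd x hx).derivWithin (uniqueDiffOn_Ici 0 x hx)
  exact contDiffOn_infty.2 fun n => key n g hg he

/-! ### The change of variable `σ = s²` -/

theorem mem_Icc_sq {s : ℝ} (hs : s ∈ Icc (0 : ℝ) 1) : s ^ 2 ∈ Icc (0 : ℝ) 1 :=
  ⟨sq_nonneg s, pow_le_one₀ hs.1 hs.2⟩

theorem mem_Icc_sqrt {s : ℝ} (hs : s ∈ Icc (0 : ℝ) 1) : Real.sqrt s ∈ Icc (0 : ℝ) 1 :=
  ⟨Real.sqrt_nonneg s, Real.sqrt_le_one.2 hs.2⟩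

theorem mem_Icc_one_sub {s : ℝ} (hs : s ∈ Icc (0 : ℝ) 1) : 1 - s ∈ Icc (0 : ℝ) 1 :=
  ⟨by linarith [hs.2], by linarith [hs.1]⟩

/-- The square root fails to be smooth only at `0`. There `φ(√σ)` is recovered from the second
function at `√(1-σ)`, which is smooth near `σ = 0`. -/
theorem contDiffOn_comp_sqrt_iff (φ : ℝ → ℝ) :
    ContDiffOn ℝ ∞ (fun σ => φ (Real.sqrt σ)) (Icc 0 1) ↔
      ContDiffOn ℝ ∞ φ (Icc 0 1) ∧
      ContDiffOn ℝ ∞ (fun s : ℝ => φ (Real.sqrt (1 - s ^ 2))) (Icc 0 1) := by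
  constructor
  · intro h
    constructor
    · refine (h.comp (f := fun s : ℝ => s ^ 2) (by fun_prop) fun s hs => mem_Icc_sq hs).congr ?_
      intro s hs
      simp [Real.sqrt_sq hs.1]
    · exact h.comp (f := fun s : ℝ => 1 - s ^ 2) (by fun_prop)
        fun s hs => mem_Icc_one_sub (mem_Icc_sq hs)
  · rintro ⟨h1, h2⟩ x hx
    rcases hx.1.eq_or_lt with h0 | h0
    · have hs : ContDiffWithinAt ℝ ∞ (fun x : ℝ => Real.sqrt (1 - x)) (Icc 0 1) x :=
        ((contDiffAt_const.sub contDiffAt_id).sqrt (by simp [← h0])).contDiffWithinAt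
      refine ((h2 _ (mem_Icc_sqrt (mem_Icc_one_sub hx))).comp x hs
        fun y hy => mem_Icc_sqrt (mem_Icc_one_sub hy)).congr_of_mem ?_ hx
      intro y hy
      simp [Real.sq_sqrt (mem_Icc_one_sub hy).1]
    · exact (h1 _ (mem_Icc_sqrt hx)).comp x (Real.contDiffAt_sqrt h0.ne').contDiffWithinAt
        fun y hy => mem_Icc_sqrt hy

/-- `f₁` and `f₂` are the first two one-sided derivatives of `f` on `[0, 1]`. -/
structure HasTwoDerivsOnUnit (f f₁ f₂ : ℝ → ℝ) : Prop where
  first : ∀ σ ∈ Icc (0 : ℝ) 1, HasDerivWithinAt f (f₁ σ) (Icc 0 1) σ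
  second : ∀ σ ∈ Icc (0 : ℝ) 1, HasDerivWithinAt f₁ (f₂ σ) (Icc 0 1) σ

theorem ContDiffOn.hasTwoDerivsOnUnit {f : ℝ → ℝ} (h : ContDiffOn ℝ ∞ f (Icc 0 1)) :
    HasTwoDerivsOnUnit f (derivWithin f (Icc 0 1))
      (derivWithin (derivWithin f (Icc 0 1)) (Icc 0 1)) := by
  have hu : UniqueDiffOn ℝ (Icc (0 : ℝ) 1) := uniqueDiffOn_Icc one_pos
  have h' := (contDiffOn_infty_iff_derivWithin hu).1 h
  exact ⟨fun σ hσ => (h'.1 σ hσ).hasDerivWithinAt,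
    fun σ hσ => ((h'.2.differentiableOn (by simp)) σ hσ).hasDerivWithinAt⟩

/-- The operator `φ - s φ' + (1 - s²) φ''` expressed in the variable `σ = s²`. -/
theorem unit_operator_eq {φ f₁ f₂ : ℝ → ℝ}
    (h : HasTwoDerivsOnUnit (fun σ => φ (Real.sqrt σ)) f₁ f₂) {s : ℝ} (hs : s ∈ Icc (0 : ℝ) 1) :
    φ s - s * derivWithin φ (Icc 0 1) s + (1 - s ^ 2) * iteratedDerivWithin 2 φ (Icc 0 1) s =
      φ (Real.sqrt (s ^ 2)) + 2 * (1 - 2 * s ^ 2) * f₁ (s ^ 2)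
        + 4 * s ^ 2 * (1 - s ^ 2) * f₂ (s ^ 2) := by
  have hu : UniqueDiffOn ℝ (Icc (0 : ℝ) 1) := uniqueDiffOn_Icc one_pos
  have hsq : ∀ s : ℝ, HasDerivWithinAt (fun s : ℝ => s ^ 2) (2 * s) (Icc 0 1) s := fun s => by
    simpa using (hasDerivAt_pow 2 s).hasDerivWithinAt
  have hmap : MapsTo (fun s : ℝ => s ^ 2) (Icc 0 1) (Icc 0 1) := fun s hs => mem_Icc_sq hs
  have hd1 : ∀ s ∈ Icc (0 : ℝ) 1, HasDerivWithinAt φ (f₁ (s ^ 2) * (2 * s)) (Icc 0 1) s := by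
    intro s hs
    refine ((h.first _ (mem_Icc_sq hs)).comp (h := fun s : ℝ => s ^ 2) s (hsq s) hmap).congr_of_mem
      ?_ hs
    intro t ht
    simp [Real.sqrt_sq ht.1]
  have hd2 : HasDerivWithinAt (fun s => f₁ (s ^ 2) * (2 * s))
      (f₂ (s ^ 2) * (2 * s) * (2 * s) + f₁ (s ^ 2) * 2) (Icc 0 1) s := by
    refine ((h.second _ (mem_Icc_sq hs)).comp (h := fun s : ℝ => s ^ 2) s (hsq s) hmap).mul ?_
    simpa using ((hasDerivAt_id s).const_mul 2).hasDerivWithinAt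
  have e1 : ∀ s ∈ Icc (0 : ℝ) 1, derivWithin φ (Icc 0 1) s = f₁ (s ^ 2) * (2 * s) :=
    fun s hs => (hd1 s hs).derivWithin (hu s hs)
  have e2 : iteratedDerivWithin 2 φ (Icc 0 1) s =
      f₂ (s ^ 2) * (2 * s) * (2 * s) + f₁ (s ^ 2) * 2 := by
    rw [iteratedDerivWithin_succ, iteratedDerivWithin_one]
    exact (hd2.congr_of_mem e1 hs).derivWithin (hu s hs)
  rw [e1 s hs, e2, Real.sqrt_sq hs.1]
  ring

theorem HasTwoDerivsOnUnit.reflect {f f₁ f₂ : ℝ → ℝ} (h : HasTwoDerivsOnUnit f f₁ f₂) :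
    HasTwoDerivsOnUnit (fun σ => f (1 - σ)) (fun σ => -f₁ (1 - σ)) (fun σ => f₂ (1 - σ)) := by
  have hr : ∀ σ : ℝ, HasDerivWithinAt (fun σ : ℝ => 1 - σ) (-1) (Icc 0 1) σ := fun σ =>
    ((hasDerivAt_id σ).const_sub 1).hasDerivWithinAt
  have hm : MapsTo (fun σ : ℝ => 1 - σ) (Icc 0 1) (Icc 0 1) := fun σ hσ => mem_Icc_one_sub hσ
  refine ⟨fun σ hσ => ?_, fun σ hσ => ?_⟩
  · exact ((h.first _ (mem_Icc_one_sub hσ)).comp σ (hr σ) hm).congr_deriv (by ring)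
  · exact ((h.second _ (mem_Icc_one_sub hσ)).comp σ (hr σ) hm).neg.congr_deriv (by ring)

/-- With `E` the expression in `hE`, the product `√(1-σ) (f - 2σf₁)` has derivative `-E / (2√(1-σ))
< 0` and vanishes at `σ = 1`, so it is positive before. -/
theorem HasTwoDerivsOnUnit.sub_pos {f f₁ f₂ : ℝ → ℝ} (h : HasTwoDerivsOnUnit f f₁ f₂)
    (hE : ∀ σ ∈ Icc (0 : ℝ) 1, 0 < f σ + 2 * (1 - 2 * σ) * f₁ σ + 4 * σ * (1 - σ) * f₂ σ) :
    ∀ σ ∈ Icc (0 : ℝ) 1, 0 < f σ - 2 * σ * f₁ σ := by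
  have hanti : StrictAntiOn (fun σ => Real.sqrt (1 - σ) * (f σ - 2 * σ * f₁ σ)) (Icc 0 1) := by
    refine strictAntiOn_of_deriv_neg (convex_Icc 0 1) ?_ ?_
    · have h0 : ContinuousOn f (Icc 0 1) := fun σ hσ => (h.first σ hσ).continuousWithinAt
      have h1 : ContinuousOn f₁ (Icc 0 1) := fun σ hσ => (h.second σ hσ).continuousWithinAt
      fun_prop
    · intro σ hσ
      rw [interior_Icc] at hσ
      have hm := Icc_mem_nhds hσ.1 hσ.2
      have hσ' := Ioo_subset_Icc_self hσ
      have h1s : 0 < 1 - σ := by linarith [hσ.2]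
      have hs := Real.sqrt_pos.2 h1s
      have d0 := (h.first σ hσ').hasDerivAt hm
      have d1 := (h.second σ hσ').hasDerivAt hm
      have ds : HasDerivAt (fun σ : ℝ => Real.sqrt (1 - σ)) (-1 / (2 * Real.sqrt (1 - σ))) σ :=
        ((hasDerivAt_id σ).const_sub 1).sqrt h1s.ne'
      have dl : HasDerivAt (fun σ : ℝ => 2 * σ) 2 σ := by
        simpa using (hasDerivAt_id σ).const_mul 2
      have e : deriv (fun σ => Real.sqrt (1 - σ) * (f σ - 2 * σ * f₁ σ)) σ =
          -(1 / (2 * Real.sqrt (1 - σ))) *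
            (f σ + 2 * (1 - 2 * σ) * f₁ σ + 4 * σ * (1 - σ) * f₂ σ) := by
        refine (ds.mul (d0.sub (dl.mul d1))).deriv.trans ?_
        simp only [Pi.sub_apply, Pi.mul_apply]
        field_simp
        rw [Real.sq_sqrt h1s.le]
        ring
      rw [e, neg_mul, neg_lt_zero]
      exact mul_pos (by positivity) (hE σ hσ')
  intro σ hσ
  -- At `σ = 1` the product gives no information, but there `E` is itself `f - 2f₁`.
  rcases hσ.2.eq_or_lt with rfl | hlt
  · have := hE 1 hσ
    linarith
  · have := hanti hσ (right_mem_Icc.2 zero_le_one) hlt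
    simp only [sub_self, Real.sqrt_zero, zero_mul] at this
    exact pos_of_mul_pos_right this (Real.sqrt_nonneg _)

/-- The reflection `σ ↦ 1 - σ`, which exchanges the roles of `V'` and `V''`, preserves `E` and
reduces this to the previous case. -/
theorem HasTwoDerivsOnUnit.add_pos {f f₁ f₂ : ℝ → ℝ} (h : HasTwoDerivsOnUnit f f₁ f₂)
    (hE : ∀ σ ∈ Icc (0 : ℝ) 1, 0 < f σ + 2 * (1 - 2 * σ) * f₁ σ + 4 * σ * (1 - σ) * f₂ σ) :
    ∀ σ ∈ Icc (0 : ℝ) 1, 0 < f σ + 2 * (1 - σ) * f₁ σ := by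
  intro σ hσ
  have := h.reflect.sub_pos (fun τ hτ => by
    have := hE _ (mem_Icc_one_sub hτ)
    ring_nf at this ⊢
    exact this) _ (mem_Icc_one_sub hσ)
  simp only [sub_sub_cancel] at this
  linarith

/-! ### Positivity of the Hessian form -/

/-- Positivity of the Hessian quadratic form at a point with `B(x, x) = a`, evaluated on
`v = β x + w` with `w` orthogonal to `x`. -/
theorem hessianForm_pos {f₀ f₁ f₂ ρ a β c q r : ℝ} (ha : 0 < a) (hf : 0 < f₀)
    (hρ : ρ ∈ Icc (0 : ℝ) 1) (h0 : 0 < f₀ - 2 * ρ * f₁) (h1 : 0 < f₀ + 2 * (1 - ρ) * f₁)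
    (h2 : 0 < f₀ + 2 * (1 - 2 * ρ) * f₁ + 4 * ρ * (1 - ρ) * f₂)
    (hr : 0 ≤ r) (hrc : r ≤ c) (hq1 : q ^ 2 ≤ a * ρ * r) (hq2 : q ^ 2 ≤ a * (1 - ρ) * (c - r))
    (hne : 0 < c ∨ β ≠ 0) :
    0 < (β ^ 2 * a + c) * f₀ ^ 2
      + 2 * f₀ * f₁ * (β ^ 2 * (ρ * a) + 2 * β * q + r - ρ * (β ^ 2 * a + c))
      + 4 * (f₁ ^ 2 + f₀ * f₂) * (β * (ρ * a) + q - ρ * (β * a)) ^ 2 / a := by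
  -- `f₀ * T` is what remains once the square in `β` is completed.
  set T := c * f₀ + 2 * f₁ * (r - ρ * c) + 4 * f₂ * q ^ 2 / a with hT
  have hid : (β ^ 2 * a + c) * f₀ ^ 2
      + 2 * f₀ * f₁ * (β ^ 2 * (ρ * a) + 2 * β * q + r - ρ * (β ^ 2 * a + c))
      + 4 * (f₁ ^ 2 + f₀ * f₂) * (β * (ρ * a) + q - ρ * (β * a)) ^ 2 / a =
      (β * a * f₀ + 2 * f₁ * q) ^ 2 / a + f₀ * T := by
    rw [hT]
    field_simp
    ring
  rw [hid]
  rcases (hr.trans hrc).eq_or_lt with hc | hc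
  · have hβ : β ≠ 0 := hne.resolve_left (by simp [← hc])
    have hr0 : r = 0 := le_antisymm (by linarith) hr
    have hq0 : q = 0 := by
      rw [hr0, mul_zero] at hq1
      exact pow_eq_zero_iff two_ne_zero |>.1 (le_antisymm hq1 (sq_nonneg q))
    have : T = 0 := by simp [hT, ← hc, hr0, hq0]
    rw [this, hq0]
    simp only [mul_zero, add_zero]
    have : β * a * f₀ ≠ 0 := mul_ne_zero (mul_ne_zero hβ ha.ne') hf.ne'
    positivity
  · have hTpos : 0 < T := by
      by_cases hint : 0 < ρ ∧ ρ < 1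
      · have hρ0 := hint.1
        have hρ1 : 0 < 1 - ρ := by linarith [hint.2]
        -- In the application, `l` is the squared length of the component of `w` in the plane of
        -- `x₁, x₂`; `r - l(1-ρ)` and `c - r - lρ` are those of the remaining parts in `V'` and
        -- `V''`. These are the weights of the three positive quantities in `T`.
        set l := q ^ 2 / (a * ρ * (1 - ρ)) with hl
        have hl0 : 0 ≤ l := by positivity
        have hq : q ^ 2 = l * (a * ρ * (1 - ρ)) := by
          rw [hl]
          field_simp
        have hl1 : 0 ≤ r - l * (1 - ρ) := by
          have : (a * ρ) * (l * (1 - ρ)) ≤ (a * ρ) * r := by linarith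
          linarith [le_of_mul_le_mul_left this (by positivity)]
        have hl2 : 0 ≤ c - r - l * ρ := by
          have : (a * (1 - ρ)) * (l * ρ) ≤ (a * (1 - ρ)) * (c - r) := by linarith
          linarith [le_of_mul_le_mul_left this (by positivity)]
        have e : T = l * (f₀ + 2 * (1 - 2 * ρ) * f₁ + 4 * ρ * (1 - ρ) * f₂)
            + (r - l * (1 - ρ)) * (f₀ + 2 * (1 - ρ) * f₁)
            + (c - r - l * ρ) * (f₀ - 2 * ρ * f₁) := by
          rw [hT, hq]
          field_simp
          ring
        have t2 := mul_nonneg hl0 h2.le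
        have t1 := mul_nonneg hl1 h1.le
        have t0 := mul_nonneg hl2 h0.le
        rw [e]
        by_contra hneg
        have z2 : l = 0 := (mul_eq_zero.1 (by linarith :
          l * (f₀ + 2 * (1 - 2 * ρ) * f₁ + 4 * ρ * (1 - ρ) * f₂) = 0)).resolve_right h2.ne'
        have z1 := (mul_eq_zero.1 (by linarith :
          (r - l * (1 - ρ)) * (f₀ + 2 * (1 - ρ) * f₁) = 0)).resolve_right h1.ne'
        have z0 := (mul_eq_zero.1 (by linarith :
          (c - r - l * ρ) * (f₀ - 2 * ρ * f₁) = 0)).resolve_right h0.ne'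
        rw [z2] at z1 z0
        linarith
      -- At `ρ = 0` or `ρ = 1` one of the bounds on `q ^ 2` forces `q = 0`, and only two terms
      -- survive.
      · have hq0 : q = 0 := by
          have : q ^ 2 ≤ 0 := by
            by_cases hρ0 : 0 < ρ
            · have : ρ = 1 := le_antisymm hρ.2 (not_lt.1 fun h => hint ⟨hρ0, h⟩)
              simpa [this] using hq2
            · have : ρ = 0 := le_antisymm (not_lt.1 hρ0) hρ.1
              simpa [this] using hq1
          exact pow_eq_zero_iff two_ne_zero |>.1 (le_antisymm this (sq_nonneg q))
        have e : T = r * (f₀ + 2 * (1 - ρ) * f₁) + (c - r) * (f₀ - 2 * ρ * f₁) := by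
          rw [hT, hq0]
          ring
        rw [e]
        rcases hr.eq_or_lt with hr0 | hr0
        · rw [← hr0]
          simpa using mul_pos hc h0
        · exact add_pos_of_pos_of_nonneg (mul_pos hr0 h1)
            (mul_nonneg (sub_nonneg.2 hrc) h0.le)
    have := mul_pos hf hTpos
    positivity

/-! ### Second derivatives along lines -/

/-- Second derivative at `0` of `½ N f(P / N)²` for quadratic polynomials `N` and `P`. -/
theorem deriv_deriv_half_mul_sq {f f₁ f₂ : ℝ → ℝ} (h : HasTwoDerivsOnUnit f f₁ f₂)
    {a b c p q r : ℝ} {N P : ℝ → ℝ} (hN : ∀ t, N t = a + 2 * b * t + c * t ^ 2)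
    (hP : ∀ t, P t = p + 2 * q * t + r * t ^ 2) (ha : 0 < a)
    (hI : ∀ t, P t / N t ∈ Icc (0 : ℝ) 1) :
    deriv (deriv fun t => 1 / 2 * (N t * f (P t / N t) ^ 2)) 0 =
      c * f (p / a) ^ 2 + 2 * f (p / a) * f₁ (p / a) * (r - p / a * c)
        + 4 * (f₁ (p / a) ^ 2 + f (p / a) * f₂ (p / a)) * (q - p / a * b) ^ 2 / a := by
  have quad : ∀ (x y z t : ℝ), HasDerivAt (fun t : ℝ => x + 2 * y * t + z * t ^ 2)
      (2 * y + 2 * z * t) t := by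
    intro x y z t
    have := (((hasDerivAt_id t).const_mul (2 * y)).const_add x).add
      ((hasDerivAt_pow 2 t).const_mul z)
    exact this.congr_deriv (by simp; ring)
  have dN : ∀ t, HasDerivAt N (2 * b + 2 * c * t) t := fun t => by
    rw [funext hN]; exact quad a b c t
  have dP : ∀ t, HasDerivAt P (2 * q + 2 * r * t) t := fun t => by
    rw [funext hP]; exact quad p q r t
  have N0 : N 0 = a := by simp [hN]
  have P0 : P 0 = p := by simp [hP]
  have hpos : ∀ᶠ t in nhds 0, 0 < N t :=
    (dN 0).continuousAt.eventually_const_lt (by rw [N0]; exact ha)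
  have dρ : ∀ t, 0 < N t → HasDerivAt (fun t => P t / N t)
      (((2 * q + 2 * r * t) - P t / N t * (2 * b + 2 * c * t)) / N t) t := by
    intro t ht
    exact ((dP t).div (dN t) ht.ne').congr_deriv (by field_simp)
  -- The ratio never leaves `[0, 1]`, so one-sided derivatives of `f` suffice for a two-sided chain
  -- rule.
  have df : ∀ t, 0 < N t → HasDerivAt (fun t => f (P t / N t))
      (f₁ (P t / N t) * (((2 * q + 2 * r * t) - P t / N t * (2 * b + 2 * c * t)) / N t)) t :=
    fun t ht => (h.first _ (hI t)).comp_hasDerivAt t (dρ t ht) (Filter.Eventually.of_forall hI)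
  have df₁ : ∀ t, 0 < N t → HasDerivAt (fun t => f₁ (P t / N t))
      (f₂ (P t / N t) * (((2 * q + 2 * r * t) - P t / N t * (2 * b + 2 * c * t)) / N t)) t :=
    fun t ht => (h.second _ (hI t)).comp_hasDerivAt t (dρ t ht) (Filter.Eventually.of_forall hI)
  -- The identity `N (P/N)' = P' - (P/N) N'` absorbs the denominator before the second
  -- differentiation.
  have e1 : deriv (fun t => 1 / 2 * (N t * f (P t / N t) ^ 2)) =ᶠ[nhds 0] fun t =>
      (b + c * t) * f (P t / N t) ^ 2 + f (P t / N t) * f₁ (P t / N t) *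
        ((2 * q + 2 * r * t) - P t / N t * (2 * b + 2 * c * t)) := by
    filter_upwards [hpos] with t ht
    refine (((dN t).mul ((df t ht).pow 2)).const_mul (1 / 2)).deriv.trans ?_
    simp only [Pi.pow_apply]
    field_simp
    push_cast
    ring
  have hp0 : 0 < N 0 := by rw [N0]; exact ha
  have lin : ∀ y z : ℝ, HasDerivAt (fun t : ℝ => y + z * t) z 0 := fun y z => by
    simpa using ((hasDerivAt_id (0 : ℝ)).const_mul z).const_add y
  rw [e1.deriv_eq]
  have := ((lin b c).mul ((df 0 hp0).pow 2)).add (((df 0 hp0).mul (df₁ 0 hp0)).mul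
    ((lin (2 * q) (2 * r)).sub ((dρ 0 hp0).mul (lin (2 * b) (2 * c)))))
  refine this.deriv.trans ?_
  simp only [Pi.pow_apply, Pi.mul_apply, Pi.sub_apply, N0, P0, mul_zero, add_zero]
  field_simp
  push_cast
  ring

/-- The Hessian evaluated on the diagonal is a second derivative along a line. -/
theorem fderiv_fderiv_apply_self {E : Type*} [NormedAddCommGroup E] [NormedSpace ℝ E]
    {L : E → ℝ} {x : E} (hL : ContDiffAt ℝ 2 L x) (v : E) :
    fderiv ℝ (fderiv ℝ L) x v v = deriv (deriv fun t : ℝ => L (x + t • v)) 0 := by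
  have hline : ∀ t : ℝ, HasDerivAt (fun t : ℝ => x + t • v) v t := fun t => by
    simpa using ((hasDerivAt_id t).smul_const v).const_add x
  have hcont : ContinuousAt (fun t : ℝ => x + t • v) 0 := (hline 0).continuousAt
  have hx0 : x + (0 : ℝ) • v = x := by simp
  have hev : ∀ᶠ y in nhds x, DifferentiableAt ℝ L y := by
    filter_upwards [hL.eventually (by simp)] with y hy
    exact hy.differentiableAt (by simp)
  have hev' : ∀ᶠ t : ℝ in nhds 0, DifferentiableAt ℝ L (x + t • v) :=
    hcont.eventually (by simpa using hev)
  have e1 : (deriv fun t : ℝ => L (x + t • v)) =ᶠ[nhds 0] fun t => fderiv ℝ L (x + t • v) v := by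
    filter_upwards [hev'] with t ht
    exact (ht.hasFDerivAt.comp_hasDerivAt t (hline t)).deriv
  have h2 : DifferentiableAt ℝ (fderiv ℝ L) x :=
    (hL.fderiv_right (m := 1) (by norm_num)).differentiableAt (by simp)
  have h3 : HasDerivAt (fun t : ℝ => fderiv ℝ L (x + t • v)) (fderiv ℝ (fderiv ℝ L) x v) 0 := by
    have h2' : HasFDerivAt (fderiv ℝ L) (fderiv ℝ (fderiv ℝ L) x) (x + (0 : ℝ) • v) := by
      rw [hx0]
      exact h2.hasFDerivAt
    exact h2'.comp_hasDerivAt 0 (hline 0)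
  rw [e1.deriv_eq]
  have h4 := h3.clm_apply (hasDerivAt_const 0 v)
  simpa using h4.deriv.symm

/-! ### The function `F`: smoothness, Hessian and sufficiency -/

section AlphaPhi

variable {E : Type*} [NormedAddCommGroup E] [NormedSpace ℝ E]
  {B : LinearMap.BilinForm ℝ E} {V' V'' : Submodule ℝ E}

theorem IsRealInnerProduct.nonneg (hB : IsRealInnerProduct B) (x : E) : 0 ≤ B x x := by
  rcases eq_or_ne x 0 with rfl | hx
  · simp
  · exact (hB.pos x hx).le

theorem IsRealInnerProduct.apply_sq_le (hB : IsRealInnerProduct B) (x y : E) :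
    B x y ^ 2 ≤ B x x * B y y := by
  have h := LinearMap.BilinForm.apply_mul_apply_le_of_forall_zero_le B hB.nonneg x y
  rw [hB.symm y x] at h
  linarith [sq (B x y)]

theorem IsRealInnerProduct.apply_add_smul (hB : IsRealInnerProduct B) (x v : E) (t : ℝ) :
    B (x + t • v) (x + t • v) = B x x + 2 * B x v * t + B v v * t ^ 2 := by
  simp only [map_add, map_smul, LinearMap.add_apply, LinearMap.smul_apply, smul_eq_mul,
    hB.symm v x]
  ring

theorem bilin_eq_add_of_orthogonal (hB : IsRealInnerProduct B) (hV : IsCompl V' V'')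
    (horth : ∀ x ∈ V', ∀ y ∈ V'', B x y = 0) (x y : E) :
    B x y = B (V'.projection V'' hV x) (V'.projection V'' hV y)
      + B (x - V'.projection V'' hV x) (y - V'.projection V'' hV y) := by
  have hx := Submodule.projection_apply_mem hV x
  have hy := Submodule.projection_apply_mem hV y
  have hx' := Submodule.sub_projection_mem hV x
  have hy' := Submodule.sub_projection_mem hV y
  have h1 := horth _ hx _ hy'
  have h2 := horth _ hy _ hx'
  rw [hB.symm] at h2
  simp only [map_sub, LinearMap.sub_apply] at h1 h2 ⊢
  linarith

theorem ratio_mem_Icc (hB : IsRealInnerProduct B) (hV : IsCompl V' V'')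
    (horth : ∀ x ∈ V', ∀ y ∈ V'', B x y = 0) (x : E) :
    B (V'.projection V'' hV x) (V'.projection V'' hV x) / B x x ∈ Icc (0 : ℝ) 1 := by
  refine ⟨div_nonneg (hB.nonneg _) (hB.nonneg _), div_le_one_of_le₀ ?_ (hB.nonneg _)⟩
  rw [bilin_eq_add_of_orthogonal hB hV horth x x]
  linarith [hB.nonneg (x - V'.projection V'' hV x)]

theorem alphaPhi_eq (hB : IsRealInnerProduct B) (hV : IsCompl V' V'') (φ : ℝ → ℝ) (x : E) :
    alphaPhi B V' V'' hV φ x = Real.sqrt (B x x) *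
      φ (Real.sqrt (B (V'.projection V'' hV x) (V'.projection V'' hV x) / B x x)) := by
  rw [Real.sqrt_div (hB.nonneg _)]
  rfl

theorem half_alphaPhi_sq (hB : IsRealInnerProduct B) (hV : IsCompl V' V'') (φ : ℝ → ℝ) (x : E) :
    1 / 2 * alphaPhi B V' V'' hV φ x ^ 2 = 1 / 2 * (B x x *
      φ (Real.sqrt (B (V'.projection V'' hV x) (V'.projection V'' hV x) / B x x)) ^ 2) := by
  rw [alphaPhi_eq hB, mul_pow, Real.sq_sqrt (hB.nonneg x)]

theorem alphaPhi_smul (hB : IsRealInnerProduct B) (hV : IsCompl V' V'') (φ : ℝ → ℝ)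
    {c : ℝ} (hc : 0 ≤ c) (x : E) :
    alphaPhi B V' V'' hV φ (c • x) = c * alphaPhi B V' V'' hV φ x := by
  rcases hc.eq_or_lt with rfl | hc
  · simp [alphaPhi_eq hB]
  · simp only [alphaPhi_eq hB, map_smul, LinearMap.smul_apply, smul_eq_mul]
    rw [← mul_assoc, ← mul_assoc, Real.sqrt_mul (by positivity), Real.sqrt_mul_self hc.le,
      mul_div_mul_left _ _ (by positivity), mul_assoc]

theorem alphaPhi_pos (hB : IsRealInnerProduct B) (hV : IsCompl V' V'')
    (horth : ∀ x ∈ V', ∀ y ∈ V'', B x y = 0) {φ : ℝ → ℝ} (hφ : ∀ s ∈ Icc (0 : ℝ) 1, 0 < φ s)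
    {x : E} (hx : x ≠ 0) : 0 < alphaPhi B V' V'' hV φ x := by
  rw [alphaPhi_eq hB]
  exact mul_pos (Real.sqrt_pos.2 (hB.pos x hx)) (hφ _ (mem_Icc_sqrt (ratio_mem_Icc hB hV horth x)))

/-- The Hessian of `½ F²` on the diagonal. -/
theorem hessian_half_alphaPhi_sq (hB : IsRealInnerProduct B) (hV : IsCompl V' V'')
    (horth : ∀ x ∈ V', ∀ y ∈ V'', B x y = 0) {φ f₁ f₂ : ℝ → ℝ}
    (h : HasTwoDerivsOnUnit (fun σ => φ (Real.sqrt σ)) f₁ f₂) {x : E} (hx : x ≠ 0)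
    (hF : ContDiffAt ℝ 2 (alphaPhi B V' V'' hV φ) x) (v : E) {ρ : ℝ}
    (hρ : B (V'.projection V'' hV x) (V'.projection V'' hV x) / B x x = ρ) :
    fderiv ℝ (fderiv ℝ fun y => (1 / 2 : ℝ) * alphaPhi B V' V'' hV φ y ^ 2) x v v =
      B v v * φ (Real.sqrt ρ) ^ 2 + 2 * φ (Real.sqrt ρ) * f₁ ρ *
          (B (V'.projection V'' hV v) (V'.projection V'' hV v) - ρ * B v v)
        + 4 * (f₁ ρ ^ 2 + φ (Real.sqrt ρ) * f₂ ρ) *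
          (B (V'.projection V'' hV x) (V'.projection V'' hV v) - ρ * B x v) ^ 2 / B x x := by
  rw [fderiv_fderiv_apply_self (contDiffAt_const.mul (hF.pow 2))]
  simp only [half_alphaPhi_sq hB]
  rw [deriv_deriv_half_mul_sq h (fun t => hB.apply_add_smul x v t) (fun t => by
    rw [map_add, map_smul]
    exact hB.apply_add_smul _ _ t) (hB.pos x hx) (fun t => ratio_mem_Icc hB hV horth _)]
  rw [hρ]

theorem hessian_half_alphaPhi_sq_pos (hB : IsRealInnerProduct B) (hV : IsCompl V' V'')
    (horth : ∀ x ∈ V', ∀ y ∈ V'', B x y = 0) {φ f₁ f₂ : ℝ → ℝ}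
    (hφ : ∀ s ∈ Icc (0 : ℝ) 1, 0 < φ s)
    (h : HasTwoDerivsOnUnit (fun σ => φ (Real.sqrt σ)) f₁ f₂)
    (hE : ∀ σ ∈ Icc (0 : ℝ) 1,
      0 < φ (Real.sqrt σ) + 2 * (1 - 2 * σ) * f₁ σ + 4 * σ * (1 - σ) * f₂ σ)
    {x : E} (hx : x ≠ 0) (hF : ContDiffAt ℝ 2 (alphaPhi B V' V'' hV φ) x) {v : E} (hv : v ≠ 0) :
    0 < fderiv ℝ (fderiv ℝ fun y => (1 / 2 : ℝ) * alphaPhi B V' V'' hV φ y ^ 2) x v v := by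
  set π := V'.projection V'' hV with hπ
  obtain ⟨ρ, hρ⟩ : ∃ ρ, B (π x) (π x) / B x x = ρ := ⟨_, rfl⟩
  have hρI : ρ ∈ Icc (0 : ℝ) 1 := hρ ▸ ratio_mem_Icc hB hV horth x
  have ha : 0 < B x x := hB.pos x hx
  rw [hessian_half_alphaPhi_sq hB hV horth h hx hF v hρ, ← hπ]
  have hp : B (π x) (π x) = ρ * B x x := by
    rw [← hρ]
    field_simp
  obtain ⟨β, w, hw, rfl⟩ : ∃ (β : ℝ) (w : E), B x w = 0 ∧ w + β • x = v := by
    refine ⟨B x v / B x x, v - (B x v / B x x) • x, ?_, by simp⟩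
    simp only [map_sub, map_smul, smul_eq_mul]
    field_simp
    ring
  have split := fun y z => bilin_eq_add_of_orthogonal hB hV horth y z
  rw [← hπ] at split
  have hxx := split x x
  have hxw := split x w
  have hww := split w w
  have hq := hB.symm (π w) (π x)
  have hr' := hB.nonneg (w - π w)
  have cs1 := hB.apply_sq_le (π x) (π w)
  have cs2 := hB.apply_sq_le (x - π x) (w - π w)
  -- Since `B x w = 0`, the `V'` and `V''` pairings are opposite, so Cauchy–Schwarz in each summand
  -- bounds the same number `q`.
  have e1 : B (x - π x) (w - π w) = -B (π x) (π w) := by linarith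
  have e2 : B (x - π x) (x - π x) = B x x * (1 - ρ) := by linarith
  have e3 : B (w - π w) (w - π w) = B w w - B (π w) (π w) := by linarith
  rw [hp] at cs1
  rw [e1, e2, e3, neg_sq] at cs2
  have key := hessianForm_pos (β := β) ha (hφ _ (mem_Icc_sqrt hρI)) hρI (h.sub_pos hE ρ hρI)
    (h.add_pos hE ρ hρI) (hE ρ hρI) (hB.nonneg (π w)) (by linarith : B (π w) (π w) ≤ B w w)
    (by linarith : B (π x) (π w) ^ 2 ≤ B x x * ρ * B (π w) (π w)) cs2 (by
      by_cases hw0 : w = 0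
      · right
        rintro rfl
        simp [hw0] at hv
      · exact Or.inl (hB.pos w hw0))
  convert key using 2
  · congr 1
    · rw [hB.apply_add_smul, hB.symm w x, hw]
      ring
    · rw [map_add, map_smul, hB.apply_add_smul, hB.apply_add_smul, hB.symm w x, hw, hp, hq]
      ring
  · simp only [map_add, map_smul, smul_eq_mul, hw, hp]
    ring

theorem contDiff_bilin_apply_self [FiniteDimensional ℝ E] (B : LinearMap.BilinForm ℝ E)
    (f : E →ₗ[ℝ] E) : ContDiff ℝ ∞ fun x => B (f x) (f x) := by
  have hf : ContDiff ℝ ∞ f := f.toContinuousLinearMap.contDiff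
  exact ((LinearMap.toContinuousBilinearMap B).contDiff.comp hf).clm_apply hf

theorem contDiffAt_alphaPhi [FiniteDimensional ℝ E] (hB : IsRealInnerProduct B)
    (hV : IsCompl V' V'') (horth : ∀ x ∈ V', ∀ y ∈ V'', B x y = 0) {φ : ℝ → ℝ}
    (h : ContDiffOn ℝ ∞ (fun σ => φ (Real.sqrt σ)) (Icc 0 1)) {x : E} (hx : x ≠ 0) :
    ContDiffAt ℝ ∞ (alphaPhi B V' V'' hV φ) x := by
  have hN : ContDiff ℝ ∞ fun x => B x x := contDiff_bilin_apply_self B LinearMap.id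
  have hP := contDiff_bilin_apply_self B (V'.projection V'' hV)
  have ha : B x x ≠ 0 := (hB.pos x hx).ne'
  have hR := hP.contDiffAt.div hN.contDiffAt ha
  -- The ratio maps the whole space into `[0, 1]` (it is `0 / 0 = 0` at the origin), so smoothness
  -- within the closed interval yields full smoothness, even where the ratio is `0` or `1`.
  have hφR := (h _ (ratio_mem_Icc hB hV horth x)).comp x
    (hR.contDiffWithinAt (s := univ)) fun y _ => ratio_mem_Icc hB hV horth y
  rw [contDiffWithinAt_univ] at hφR
  rw [funext fun y => alphaPhi_eq hB hV φ y]
  exact (hN.contDiffAt.sqrt ha).mul hφR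

theorem continuous_alphaPhi [FiniteDimensional ℝ E] (hB : IsRealInnerProduct B)
    (hV : IsCompl V' V'') (horth : ∀ x ∈ V', ∀ y ∈ V'', B x y = 0) {φ : ℝ → ℝ}
    (h : ContDiffOn ℝ ∞ (fun σ => φ (Real.sqrt σ)) (Icc 0 1)) :
    Continuous (alphaPhi B V' V'' hV φ) := by
  rw [continuous_iff_continuousAt]
  intro x
  rcases eq_or_ne x 0 with rfl | hx
  · obtain ⟨C, hC⟩ := isCompact_Icc.exists_bound_of_continuousOn h.continuousOn
    have hN : Continuous fun x => Real.sqrt (B x x) * C :=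
      ((contDiff_bilin_apply_self B LinearMap.id).continuous.sqrt).mul_const C
    have h0 : alphaPhi B V' V'' hV φ 0 = 0 := by simp [alphaPhi_eq hB]
    rw [ContinuousAt, h0]
    refine squeeze_zero_norm (fun y => ?_) (by simpa using hN.tendsto 0)
    rw [alphaPhi_eq hB, norm_mul, Real.norm_of_nonneg (Real.sqrt_nonneg _)]
    exact mul_le_mul_of_nonneg_left (hC _ (ratio_mem_Icc hB hV horth y)) (Real.sqrt_nonneg _)
  · exact (contDiffAt_alphaPhi hB hV horth h hx).continuousAt

theorem isMinkowskiNorm_alphaPhi [FiniteDimensional ℝ E] (hB : IsRealInnerProduct B)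
    (hV : IsCompl V' V'') (horth : ∀ x ∈ V', ∀ y ∈ V'', B x y = 0) {φ f₁ f₂ : ℝ → ℝ}
    (hφ : ∀ s ∈ Icc (0 : ℝ) 1, 0 < φ s)
    (hs : ContDiffOn ℝ ∞ (fun σ => φ (Real.sqrt σ)) (Icc 0 1))
    (h : HasTwoDerivsOnUnit (fun σ => φ (Real.sqrt σ)) f₁ f₂)
    (hE : ∀ σ ∈ Icc (0 : ℝ) 1,
      0 < φ (Real.sqrt σ) + 2 * (1 - 2 * σ) * f₁ σ + 4 * σ * (1 - σ) * f₂ σ) :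
    IsMinkowskiNorm (alphaPhi B V' V'' hV φ) where
  continuous := continuous_alphaPhi hB hV horth hs
  pos _ hx := alphaPhi_pos hB hV horth hφ hx
  smooth _ hx := (contDiffAt_alphaPhi hB hV horth hs hx).contDiffWithinAt
  homogeneous _ hc x := alphaPhi_smul hB hV φ hc x
  stronglyConvex _ hx _ hv := hessian_half_alphaPhi_sq_pos hB hV horth hφ h hE hx
    ((contDiffAt_alphaPhi hB hV horth hs hx).of_le (WithTop.coe_le_coe.2 le_top)) hv

/-! ### Necessity: restriction to a plane -/

theorem exists_unit_mem (hB : IsRealInnerProduct B) {V : Submodule ℝ E}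
    (hV : 0 < Module.finrank ℝ V) : ∃ e ∈ V, B e e = 1 := by
  obtain ⟨x, hx, hx0⟩ := V.exists_mem_ne_zero_of_ne_bot (by
    rintro rfl
    simp at hV)
  have hp := hB.pos x hx0
  refine ⟨(Real.sqrt (B x x))⁻¹ • x, V.smul_mem _ hx, ?_⟩
  have := Real.sqrt_pos.2 hp
  simp only [map_smul, LinearMap.smul_apply, smul_eq_mul]
  field_simp
  rw [Real.sq_sqrt hp.le]

section Plane

variable {e₁ e₂ : E}

theorem projection_plane (hV : IsCompl V' V'') (h₁ : e₁ ∈ V') (h₂ : e₂ ∈ V'') (u w : ℝ) :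
    V'.projection V'' hV (u • e₁ + w • e₂) = u • e₁ := by
  rw [map_add, map_smul, map_smul, Submodule.projection_apply_of_mem_left hV h₁,
    (Submodule.projection_apply_eq_zero_iff hV).2 h₂, smul_zero, add_zero]

theorem bilin_plane (hB : IsRealInnerProduct B) (n₁ : B e₁ e₁ = 1) (n₂ : B e₂ e₂ = 1)
    (h₁₂ : B e₁ e₂ = 0) (u w u' w' : ℝ) :
    B (u • e₁ + w • e₂) (u' • e₁ + w' • e₂) = u * u' + w * w' := by
  simp only [map_add, map_smul, LinearMap.add_apply, LinearMap.smul_apply, smul_eq_mul,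
    hB.symm e₂ e₁, n₁, n₂, h₁₂]
  ring

theorem alphaPhi_plane (hB : IsRealInnerProduct B) (hV : IsCompl V' V'') (φ : ℝ → ℝ)
    (h₁ : e₁ ∈ V') (h₂ : e₂ ∈ V'') (n₁ : B e₁ e₁ = 1) (n₂ : B e₂ e₂ = 1) (h₁₂ : B e₁ e₂ = 0)
    (u w : ℝ) :
    alphaPhi B V' V'' hV φ (u • e₁ + w • e₂) =
      Real.sqrt (u ^ 2 + w ^ 2) * φ (Real.sqrt (u ^ 2 / (u ^ 2 + w ^ 2))) := by
  rw [alphaPhi_eq hB, projection_plane hV h₁ h₂, bilin_plane hB n₁ n₂ h₁₂]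
  simp only [map_smul, LinearMap.smul_apply, smul_eq_mul, n₁, mul_one, ← sq]

theorem plane_ne_zero (hB : IsRealInnerProduct B) (n₁ : B e₁ e₁ = 1) (n₂ : B e₂ e₂ = 1)
    (h₁₂ : B e₁ e₂ = 0) {u w : ℝ} (h : 0 < u ^ 2 + w ^ 2) : u • e₁ + w • e₂ ≠ 0 := by
  intro h0
  have := bilin_plane hB n₁ n₂ h₁₂ u w u w
  rw [h0, map_zero] at this
  nlinarith [this]

theorem IsMinkowskiNorm.contDiffAt {F : E → ℝ} (hF : IsMinkowskiNorm F) {x : E} (hx : x ≠ 0) :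
    ContDiffAt ℝ ∞ F x :=
  (hF.smooth x hx).contDiffAt (isOpen_ne.mem_nhds hx)

/-- By homogeneity `f(σ) = √(1-σ) F(t e₁ + e₂)` with `t² = σ/(1-σ)`. The last factor is even in `t`,
hence smooth in `t²`. This covers `σ < 1`; exchanging `e₁` and `e₂` covers `σ = 1`. -/
theorem contDiffOn_profile_of_isMinkowskiNorm (hB : IsRealInnerProduct B) (hV : IsCompl V' V'')
    {φ : ℝ → ℝ} (h₁ : e₁ ∈ V') (h₂ : e₂ ∈ V'') (n₁ : B e₁ e₁ = 1) (n₂ : B e₂ e₂ = 1)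
    (h₁₂ : B e₁ e₂ = 0) (hF : IsMinkowskiNorm (alphaPhi B V' V'' hV φ)) :
    ContDiffOn ℝ ∞ (fun σ => φ (Real.sqrt σ)) (Icc 0 1) := by
  have hplane := alphaPhi_plane hB hV φ h₁ h₂ n₁ n₂ h₁₂
  set F := alphaPhi B V' V'' hV φ with hFdef
  have hg : ContDiff ℝ ∞ fun t : ℝ => F (t • e₁ + (1 : ℝ) • e₂) := by
    rw [contDiff_iff_contDiffAt]
    intro t
    exact (hF.contDiffAt (plane_ne_zero hB n₁ n₂ h₁₂ (by positivity))).comp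
      (f := fun t : ℝ => t • e₁ + (1 : ℝ) • e₂) t (by fun_prop)
  have hk : ContDiff ℝ ∞ fun t : ℝ => F ((1 : ℝ) • e₁ + t • e₂) := by
    rw [contDiff_iff_contDiffAt]
    intro t
    exact (hF.contDiffAt (plane_ne_zero hB n₁ n₂ h₁₂ (by positivity))).comp
      (f := fun t : ℝ => (1 : ℝ) • e₁ + t • e₂) t (by fun_prop)
  have hg' := contDiffOn_comp_sqrt_of_even hg (fun t => by rw [hplane, hplane, neg_sq])
  have hk' := contDiffOn_comp_sqrt_of_even hk (fun t => by rw [hplane, hplane, neg_sq])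
  intro σ hσ
  rcases hσ.2.lt_or_eq with hlt | heq
  · have hne : 1 - σ ≠ 0 := by linarith
    have hq : ContDiffWithinAt ℝ ∞ (fun σ : ℝ => σ / (1 - σ)) (Icc 0 1) σ :=
      (contDiffAt_id.div (contDiffAt_const.sub contDiffAt_id) hne).contDiffWithinAt
    have hs : ContDiffWithinAt ℝ ∞ (fun σ : ℝ => Real.sqrt (1 - σ)) (Icc 0 1) σ :=
      ((contDiffAt_const.sub contDiffAt_id).sqrt hne).contDiffWithinAt
    have hm : ∀ y ∈ Icc (0 : ℝ) 1, y / (1 - y) ∈ Ici (0 : ℝ) :=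
      fun y hy => div_nonneg hy.1 (by linarith [hy.2])
    have hc := hs.mul ((hg' _ (hm σ hσ)).comp (f := fun σ : ℝ => σ / (1 - σ)) σ hq hm)
    refine hc.congr_of_eventuallyEq_of_mem ?_ hσ
    filter_upwards [self_mem_nhdsWithin, mem_nhdsWithin_of_mem_nhds (Iio_mem_nhds hlt)] with y hy hy1
    have hy1' : 0 < 1 - y := by linarith [mem_Iio.1 hy1]
    have e : y / (1 - y) + 1 = (1 - y)⁻¹ := by
      field_simp
      ring
    simp only [Function.comp_apply]
    rw [hplane, Real.sq_sqrt (hm y hy), one_pow, e, ← mul_assoc, ← Real.sqrt_mul hy1'.le,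
      mul_inv_cancel₀ hy1'.ne', Real.sqrt_one, one_mul]
    congr 2
    field_simp
  · have hpos : 0 < σ := by linarith
    have hq : ContDiffWithinAt ℝ ∞ (fun σ : ℝ => (1 - σ) / σ) (Icc 0 1) σ :=
      ((contDiffAt_const.sub contDiffAt_id).div contDiffAt_id hpos.ne').contDiffWithinAt
    have hs : ContDiffWithinAt ℝ ∞ (fun σ : ℝ => Real.sqrt σ) (Icc 0 1) σ :=
      (Real.contDiffAt_sqrt hpos.ne').contDiffWithinAt
    have hm : ∀ y ∈ Icc (0 : ℝ) 1, (1 - y) / y ∈ Ici (0 : ℝ) :=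
      fun y hy => div_nonneg (by linarith [hy.2]) hy.1
    have hc := hs.mul ((hk' _ (hm σ hσ)).comp (f := fun σ : ℝ => (1 - σ) / σ) σ hq hm)
    refine hc.congr_of_eventuallyEq_of_mem ?_ hσ
    filter_upwards [self_mem_nhdsWithin, mem_nhdsWithin_of_mem_nhds (Ioi_mem_nhds hpos)] with y hy hy0
    have hy0' : 0 < y := hy0
    have e : 1 + (1 - y) / y = y⁻¹ := by
      field_simp
      ring
    simp only [Function.comp_apply]
    rw [hplane, Real.sq_sqrt (hm y hy), one_pow, e, ← mul_assoc, ← Real.sqrt_mul hy0'.le,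
      mul_inv_cancel₀ hy0'.ne', Real.sqrt_one, one_mul, one_div, inv_inv]

theorem operator_pos_of_isMinkowskiNorm (hB : IsRealInnerProduct B) (hV : IsCompl V' V'')
    (horth : ∀ x ∈ V', ∀ y ∈ V'', B x y = 0) {φ f₁ f₂ : ℝ → ℝ}
    (hφ : ∀ s ∈ Icc (0 : ℝ) 1, 0 < φ s)
    (h : HasTwoDerivsOnUnit (fun σ => φ (Real.sqrt σ)) f₁ f₂)
    (h₁ : e₁ ∈ V') (h₂ : e₂ ∈ V'') (n₁ : B e₁ e₁ = 1) (n₂ : B e₂ e₂ = 1)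
    (hF : IsMinkowskiNorm (alphaPhi B V' V'' hV φ)) {σ : ℝ} (hσ : σ ∈ Icc (0 : ℝ) 1) :
    0 < φ (Real.sqrt σ) + 2 * (1 - 2 * σ) * f₁ σ + 4 * σ * (1 - σ) * f₂ σ := by
  have h₁₂ : B e₁ e₂ = 0 := horth _ h₁ _ h₂
  obtain ⟨c, hc⟩ : ∃ c, Real.sqrt σ = c := ⟨_, rfl⟩
  obtain ⟨s, hs⟩ : ∃ s, Real.sqrt (1 - σ) = s := ⟨_, rfl⟩
  have hc2 : c ^ 2 = σ := by rw [← hc, Real.sq_sqrt hσ.1]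
  have hs2 : s ^ 2 = 1 - σ := by rw [← hs, Real.sq_sqrt (by linarith [hσ.2])]
  have hf : 0 < φ (Real.sqrt σ) := hφ _ (mem_Icc_sqrt hσ)
  -- This `β` annihilates the completed square in direction `v = βx + w`, where `x = c e₁ + s e₂`
  -- and `w = s e₁ - c e₂` are orthonormal. The Hessian is then `φ(√σ)` times the claimed
  -- expression.
  obtain ⟨β, hβ⟩ : ∃ β, β * φ (Real.sqrt σ) = -2 * f₁ σ * (c * s) :=
    ⟨-2 * f₁ σ * (c * s) / φ (Real.sqrt σ), by field_simp⟩
  have hx : c • e₁ + s • e₂ ≠ 0 := plane_ne_zero hB n₁ n₂ h₁₂ (by linarith)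
  have hv : (β * c + s) • e₁ + (β * s - c) • e₂ ≠ 0 := plane_ne_zero hB n₁ n₂ h₁₂ (by
    nlinarith [sq_nonneg β])
  have key := hF.stronglyConvex _ hx _ hv
  rw [hessian_half_alphaPhi_sq hB hV horth h hx
    ((hF.contDiffAt hx).of_le (WithTop.coe_le_coe.2 le_top)) _ (ρ := σ) (by
      rw [projection_plane hV h₁ h₂, bilin_plane hB n₁ n₂ h₁₂]
      simp only [map_smul, LinearMap.smul_apply, smul_eq_mul, n₁]
      rw [← sq, ← sq, hc2, hs2]
      rw [add_sub_cancel, div_one, mul_one, ← sq, hc2])] at key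
  simp only [projection_plane hV h₁ h₂, bilin_plane hB n₁ n₂ h₁₂] at key
  simp only [map_smul, LinearMap.smul_apply, smul_eq_mul, n₁] at key
  have a1 : c * c + s * s = 1 := by linarith [sq c, sq s]
  have ec : (β * c + s) * (β * c + s) + (β * s - c) * (β * s - c) = β ^ 2 + 1 := by
    linear_combination (β ^ 2 + 1) * a1
  have eb : c * (β * c + s) + s * (β * s - c) = β := by linear_combination β * a1
  rw [ec, eb, a1, div_one] at key
  have er : (β * c + s) * ((β * c + s) * 1) - σ * (β ^ 2 + 1) =
      2 * β * (c * s) + (1 - 2 * σ) := by linear_combination β ^ 2 * hc2 + hs2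
  have eq : (β * c + s) * (c * 1) - σ * β = c * s := by linear_combination β * hc2
  have ecs : (c * s) ^ 2 = σ * (1 - σ) := by rw [mul_pow, hc2, hs2]
  rw [er, eq] at key
  refine pos_of_mul_pos_right (a := φ (Real.sqrt σ)) (lt_of_lt_of_eq key ?_) hf.le
  linear_combination (β * φ (Real.sqrt σ) + 2 * f₁ σ * (c * s)) * hβ
    + 4 * φ (Real.sqrt σ) * f₂ σ * ecs

end Plane

end AlphaPhi

theorem corollary3p3 (n : ℕ) (hn : 2 ≤ n)
    (B : LinearMap.BilinForm ℝ (EuclideanSpace ℝ (Fin n))) (hB : IsRealInnerProduct B)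
    (V' V'' : Submodule ℝ (EuclideanSpace ℝ (Fin n))) (hV : IsCompl V' V'')
    (horth : ∀ x ∈ V', ∀ y ∈ V'', B x y = 0)
    (hpos : 0 < Module.finrank ℝ V') (hlt : Module.finrank ℝ V' < n)
    (φ : ℝ → ℝ) (hφ : ∀ s ∈ Set.Icc (0 : ℝ) 1, 0 < φ s) :
    IsMinkowskiNorm (alphaPhi B V' V'' hV φ) ↔
      ContDiffOn ℝ ∞ φ (Set.Icc 0 1) ∧
      ContDiffOn ℝ ∞ (fun s : ℝ => φ (Real.sqrt (1 - s ^ 2))) (Set.Icc 0 1) ∧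
      ∀ s ∈ Set.Icc (0 : ℝ) 1,
        0 < φ s - s * derivWithin φ (Set.Icc 0 1) s +
          (1 - s ^ 2) * iteratedDerivWithin 2 φ (Set.Icc 0 1) s := by
  have hpos'' : 0 < Module.finrank ℝ V'' := by
    have := Submodule.finrank_add_eq_of_isCompl hV
    rw [finrank_euclideanSpace_fin] at this
    omega
  obtain ⟨e₁, h₁, n₁⟩ := exists_unit_mem hB hpos
  obtain ⟨e₂, h₂, n₂⟩ := exists_unit_mem hB hpos''
  constructor
  · intro hF
    have hs := contDiffOn_profile_of_isMinkowskiNorm hB hV h₁ h₂ n₁ n₂ (horth _ h₁ _ h₂) hF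
    obtain ⟨hs₁, hs₂⟩ := (contDiffOn_comp_sqrt_iff φ).1 hs
    refine ⟨hs₁, hs₂, fun s hsI => ?_⟩
    rw [unit_operator_eq hs.hasTwoDerivsOnUnit hsI]
    exact operator_pos_of_isMinkowskiNorm hB hV horth hφ hs.hasTwoDerivsOnUnit h₁ h₂ n₁ n₂ hF
      (mem_Icc_sq hsI)
  · rintro ⟨hs₁, hs₂, hE⟩
    have hs := (contDiffOn_comp_sqrt_iff φ).2 ⟨hs₁, hs₂⟩
    refine isMinkowskiNorm_alphaPhi hB hV horth hφ hs hs.hasTwoDerivsOnUnit fun σ hσ => ?_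
    have := hE _ (mem_Icc_sqrt hσ)
    rwa [unit_operator_eq hs.hasTwoDerivsOnUnit (mem_Icc_sqrt hσ), Real.sq_sqrt hσ.1] at this
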